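/- Notation. For a set $R$ of pairs of words over an alphabet $A$, $\langle A\mid R\rangle$ is the monoid presented by the alphabet $A$ and the relations $u=v$, $(u,v)\in R$; the presentation is homogeneous if $|u|=|v|$ for all $(u,v)\in R$, and multihomogeneous if, for all $(u,v)\in R$, every letter occurs equally often in $u$ and in $v$. Elements $p,q$ of a monoid $M$ are $o$-conjugate, $p\sim_o q$, if there are $g,h\in M$ with $pg=gq$ and $hp=qh$. The $o$-conjugacy problem of a finite presentation $\langle A\mid R\rangle$ ($A$ and $R$ finite) asks, given two words over $A$, whether they represent $o$-conjugate elements; it is undecidable if no algorithm solves it on all inputs. For $A=\{a_1,\dots,a_n\}$ let $\phi:A^*\to\{x,y\}^*$ be the homomorphism with $a_i\mapsto x^2y^ixy^{\,n-i+1}$, and for $R\subseteq A^*\times A^*$ let $R\phi=\{(u\phi,v\phi):(u,v)\in R\}$. Theorem. (1) There is a finitely presented multihomogeneous monoid whose $o$-conjugacy problem is undecidable. More precisely, there are a finite alphabet $A=\{a_1,\dots,a_n\}$ and a finite homogeneous set $R$ of relations over $A$ such that the $o$-conjugacy problem of $\langle A\mid R\rangle$ is undecidable, the presentation $\langle x,y\mid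 R\phi\rangle$ is finite and multihomogeneous, and its $o$-conjugacy problem is undecidable. (2) For every $n\ge 0$, $A=\{a_1,\dots,a_n\}$, and every homogeneous presentation $M=\langle A\mid R\rangle$ (with $R$ finite or infinite), the presentation $N=\langle x,y\mid R\phi\rangle$ is multihomogeneous, $\phi$ induces an injective homomorphism $f:M\to N$, and for all $p,q\in M$ one has $f(p)\sim_o f(q)$ in $N$ if and only if $p\sim_o q$ in $M$. -/

import Mathlib

/-- Two elements `p`, `q` of a monoid `M` are `o`-conjugate if there are `g`, `h` in `M` with
`p g = g q` and `h p = q h`.  (For a monoid, adjoining an identity is not needed: `M¹ = M`.) -/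
def OConj {M : Type*} [Monoid M] (p q : M) : Prop :=
  ∃ g h : M, p * g = g * q ∧ h * p = q * h

/-- The monoid presented by the alphabet `α` and the set `R` of defining relations, a relation
being a pair of words over `α`. -/
abbrev PresMonoid {α : Type*} (R : Set (FreeMonoid α × FreeMonoid α)) : Type _ :=
  PresentedMonoid (fun u v : FreeMonoid α => (u, v) ∈ R)

/-- The element of the presented monoid that a word represents. -/
abbrev PresMonoid.word {α : Type*} (R : Set (FreeMonoid α × FreeMonoid α)) :
    FreeMonoid α →* PresMonoid R :=
  PresentedMonoid.mk (fun u v : FreeMonoid α => (u, v) ∈ R)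

/-- A presentation is homogeneous if the two sides of each relation have the same length. -/
def IsHomogeneous {α : Type*} (R : Set (FreeMonoid α × FreeMonoid α)) : Prop :=
  ∀ r ∈ R, (FreeMonoid.toList r.1).length = (FreeMonoid.toList r.2).length

/-- A presentation is multihomogeneous if the two sides of each relation have the same content,
i.e. contain each letter the same number of times. -/
def IsMultihomogeneous {α : Type*} [DecidableEq α]
    (R : Set (FreeMonoid α × FreeMonoid α)) : Prop :=
  ∀ r ∈ R, ∀ a : α, (FreeMonoid.toList r.1).count a = (FreeMonoid.toList r.2).count a

/-- The `o`-conjugacy problem of a presentation is decidable if there is an algorithm that, given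
two words over the alphabet, decides whether they represent `o`-conjugate elements. -/
def OConjDecidable {α : Type*} [Primcodable α]
    (R : Set (FreeMonoid α × FreeMonoid α)) : Prop :=
  ComputablePred (fun w : List α × List α =>
    OConj (PresMonoid.word R (FreeMonoid.ofList w.1)) (PresMonoid.word R (FreeMonoid.ofList w.2)))

/-- The letter `x` of the two-letter alphabet. -/
def letterX : FreeMonoid (Fin 2) := FreeMonoid.of 0

/-- The letter `y` of the two-letter alphabet. -/
def letterY : FreeMonoid (Fin 2) := FreeMonoid.of 1

/-- The homomorphism from words over `{a₁, …, aₙ}` to words over `{x, y}` that sends `aᵢ` to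
`x² yⁱ x yⁿ⁻ⁱ⁺¹`.  The letter `aᵢ` is the element `i - 1` of `Fin n`, so `k : Fin n` is sent to
`x² yᵏ⁺¹ x yⁿ⁻ᵏ`. -/
def encode (n : ℕ) : FreeMonoid (Fin n) →* FreeMonoid (Fin 2) :=
  FreeMonoid.lift (fun k : Fin n =>
    letterX ^ 2 * letterY ^ ((k : ℕ) + 1) * letterX * letterY ^ (n - (k : ℕ)))

/-- The set of relations `(encode u, encode v)` for `(u, v)` in `R`. -/
def encodeRel {n : ℕ} (R : Set (FreeMonoid (Fin n) × FreeMonoid (Fin n))) :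
    Set (FreeMonoid (Fin 2) × FreeMonoid (Fin 2)) :=
  (fun r => (encode n r.1, encode n r.2)) '' R

/-!
Every codeword `x² yⁱ x yⁿ⁻ⁱ⁺¹` begins with `xx`, which occurs nowhere else in it, and ends in `y`.
So codewords never overlap in a word, and a relation of `Rφ` either leaves the longest prefix of the
form `aφ` unchanged or changes `a` by a relation of `R`.  Hence decoding this prefix is compatible
with the relations, and it inverts `f`.  If `g = (aφ) x` with no codeword as a prefix of `x ≠ 1`,
then decoding `f p * g = g * f q` yields `p * a = a * q` or `p * a = a`; in the latter case `p` and
`q` are trivial, since the relations preserve lengths.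

For the undecidability, a program is evaluated in a finitely presented monoid in the manner of Post
and Markov: a letter stands for the program, and relations let it act on a word that spells out its
input.  An action on stacks shows that the relations do not identify too much.  A central letter
pads the relations, which makes them homogeneous, and a marker letter in front of two words of equal
length makes their `o`-conjugacy equivalent to equality in the original monoid.
-/

open FreeMonoid

theorem OConj.map {M N : Type*} [Monoid M] [Monoid N] (f : M →* N) {p q : M} :
    OConj p q → OConj (f p) (f q) := by
  rintro ⟨g, h, hg, hh⟩
  exact ⟨f g, f h, by rw [← map_mul, hg, map_mul], by rw [← map_mul, hh, map_mul]⟩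

section Presentations

variable {α β M : Type*} [Monoid M] {R : Set (FreeMonoid α × FreeMonoid α)} {u v : FreeMonoid α}

/-- The syntactic congruence of a function `F` on a monoid: the coarsest congruence along which
`F` is constant.  It shows that `F` is well defined on a presented monoid. -/
def syntacticCon {γ : Type*} (F : M → γ) : Con M where
  r u v := ∀ s t, F (s * u * t) = F (s * v * t)
  iseqv := ⟨fun _ _ _ => rfl, fun h s t => (h s t).symm, fun h k s t => (h s t).trans (k s t)⟩
  mul' {u v u' v'} h k s t := by
    have hu := h s (u' * t)
    have hv := k (s * v) t
    simp only [mul_assoc] at hu hv ⊢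
    exact hu.trans hv

namespace PresMonoid

theorem con_of_word_eq {c : Con (FreeMonoid α)} (hc : ∀ r ∈ R, c r.1 r.2)
    (h : word R u = word R v) : c u v :=
  Con.conGen_le.2 (fun u v huv => hc (u, v) huv) (PresentedMonoid.mk_eq_mk_iff.1 h)

theorem apply_eq_of_word_eq {γ : Type*} {F : FreeMonoid α → γ}
    (hF : ∀ r ∈ R, ∀ s t, F (s * r.1 * t) = F (s * r.2 * t)) (h : word R u = word R v) :
    F u = F v := by
  simpa using con_of_word_eq (c := syntacticCon F) hF h 1 1

theorem word_eq_of_mem {r : FreeMonoid α × FreeMonoid α} (hr : r ∈ R) :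
    word R r.1 = word R r.2 :=
  PresentedMonoid.mk_eq_mk_of_rel hr

/-- The homomorphism on a presented monoid that a homomorphism on words induces if it respects the
relations. -/
def liftHom (φ : FreeMonoid α →* M) (h : ∀ r ∈ R, φ r.1 = φ r.2) : PresMonoid R →* M :=
  PresentedMonoid.lift (φ ∘ of) fun u v huv => by
    rw [lift_restrict]
    exact h (u, v) huv

theorem liftHom_word (φ : FreeMonoid α →* M) (h : ∀ r ∈ R, φ r.1 = φ r.2) (u : FreeMonoid α) :
    liftHom φ h (word R u) = φ u :=
  DFunLike.congr_fun (lift_restrict φ) u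

end PresMonoid

/-- The image of a set of relations under a homomorphism of words.  Both `encodeRel` and a change
of alphabet are instances. -/
def imageRel (φ : FreeMonoid α →* FreeMonoid β) (R : Set (FreeMonoid α × FreeMonoid α)) :
    Set (FreeMonoid β × FreeMonoid β) :=
  Prod.map φ φ '' R

namespace PresMonoid

/-- The homomorphism of presented monoids that a homomorphism of words induces. -/
def imageHom (φ : FreeMonoid α →* FreeMonoid β) (R : Set (FreeMonoid α × FreeMonoid α)) :
    PresMonoid R →* PresMonoid (imageRel φ R) :=
  liftHom ((word (imageRel φ R)).comp φ) fun _ hr =>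
    word_eq_of_mem (R := imageRel φ R) (Set.mem_image_of_mem _ hr)

theorem imageHom_word (φ : FreeMonoid α →* FreeMonoid β) (u : FreeMonoid α) :
    imageHom φ R (word R u) = word (imageRel φ R) (φ u) :=
  liftHom_word _ _ u

end PresMonoid

theorem IsHomogeneous.length_eq (hR : IsHomogeneous R)
    (h : PresMonoid.word R u = PresMonoid.word R v) : u.length = v.length :=
  PresMonoid.apply_eq_of_word_eq (fun r hr s t => by
    simp only [length_mul]
    exact congrArg (s.length + · + t.length) (hR r hr)) h

theorem IsMultihomogeneous.isHomogeneous [DecidableEq α] (hR : IsMultihomogeneous R) :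
    IsHomogeneous R :=
  fun r hr => (List.perm_iff_count.2 (hR r hr)).length_eq

theorem toList_of_pow (a : α) (k : ℕ) : toList (of a ^ k) = List.replicate k a := by
  induction k with
  | zero => rfl
  | succ k ih => rw [pow_succ', toList_mul, ih]; rfl

theorem toList_hom_ofList (φ : FreeMonoid α →* FreeMonoid β) (w : List α) :
    toList (φ (ofList w)) = w.flatMap fun a => toList (φ (of a)) := by
  induction w with
  | nil => simp
  | cons a w ih => rw [ofList_cons, map_mul, toList_mul, ih, List.flatMap_cons]

end Presentations

section SolidCodes

variable {α β : Type*} {φ : FreeMonoid α →* FreeMonoid β}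

/-- The images of the letters form a solid code: in no word do two occurrences of codewords
overlap.  The two fields treat occurrences that start at the same place and at different places. -/
structure IsSolidCode (φ : FreeMonoid α →* FreeMonoid β) : Prop where
  ne_one (a : α) : φ (of a) ≠ 1
  eq_of_mul_eq {a b : α} {s t : FreeMonoid β} : φ (of a) * s = φ (of b) * t → a = b
  exists_eq_mul {a b : α} {s t x : FreeMonoid β} : s ≠ 1 → s * (φ (of b) * t) = φ (of a) * x →
    ∃ y, s = φ (of a) * y

/-- A word that does not begin with a codeword. -/
def NoCodePrefix (φ : FreeMonoid α →* FreeMonoid β) (w : FreeMonoid β) : Prop :=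
  ∀ a x, w ≠ φ (of a) * x

namespace IsSolidCode

theorem noCodePrefix_one (hφ : IsSolidCode φ) : NoCodePrefix φ 1 := by
  intro a x h
  have hlen := congrArg FreeMonoid.length h
  rw [length_mul, length_one] at hlen
  exact hφ.ne_one a (length_eq_zero.1 (by lia))

theorem noCodePrefix_mul (hφ : IsSolidCode φ) {s : FreeMonoid β} (hs : NoCodePrefix φ s)
    (hs1 : s ≠ 1) {u : FreeMonoid α} (hu : u ≠ 1) (t : FreeMonoid β) :
    NoCodePrefix φ (s * (φ u * t)) := by
  intro a x h
  cases u using FreeMonoid.casesOn with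
  | one => exact hu rfl
  | of_mul b u =>
    rw [map_mul, mul_assoc] at h
    obtain ⟨y, hy⟩ := hφ.exists_eq_mul hs1 h
    exact hs a y hy

theorem exists_eq_map_mul (hφ : IsSolidCode φ) (w : FreeMonoid β) :
    ∃ a x, w = φ a * x ∧ NoCodePrefix φ x := by
  induction hl : w.length using Nat.strong_induction_on generalizing w with
  | _ l ih =>
    by_cases hw : NoCodePrefix φ w
    · exact ⟨1, w, by rw [map_one, one_mul], hw⟩
    · simp only [NoCodePrefix, not_forall, not_not] at hw
      obtain ⟨b, y, rfl⟩ := hw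
      have hb : (φ (of b)).length ≠ 0 := fun h => hφ.ne_one b (length_eq_zero.1 h)
      obtain ⟨a, x, rfl, hx⟩ := ih y.length (by rw [← hl, length_mul]; lia) y rfl
      exact ⟨of b * a, x, by rw [map_mul, mul_assoc], hx⟩

theorem eq_of_map_mul_eq (hφ : IsSolidCode φ) {a b : FreeMonoid α} {x y : FreeMonoid β}
    (hx : NoCodePrefix φ x) (hy : NoCodePrefix φ y) (h : φ a * x = φ b * y) : a = b := by
  induction a using FreeMonoid.inductionOn' generalizing b with
  | one =>
    cases b using FreeMonoid.casesOn with
    | one => rfl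
    | of_mul k b =>
      rw [map_one, one_mul, map_mul, mul_assoc] at h
      exact absurd h (hx k _)
  | of_mul j a ih =>
    cases b using FreeMonoid.casesOn with
    | one =>
      rw [map_one, one_mul, map_mul, mul_assoc] at h
      exact absurd h.symm (hy j _)
    | of_mul k b =>
      simp only [map_mul, mul_assoc] at h
      obtain rfl := hφ.eq_of_mul_eq h
      rw [ih (mul_left_cancel h)]

/-- The decoding of the longest prefix of a word that is a product of codewords. -/
noncomputable def decodePrefix (hφ : IsSolidCode φ) (w : FreeMonoid β) : FreeMonoid α :=
  (hφ.exists_eq_map_mul w).choose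

theorem decodePrefix_eq (hφ : IsSolidCode φ) (a : FreeMonoid α) {x : FreeMonoid β}
    (hx : NoCodePrefix φ x) : hφ.decodePrefix (φ a * x) = a := by
  obtain ⟨y, h, hy⟩ := (hφ.exists_eq_map_mul (φ a * x)).choose_spec
  exact (hφ.eq_of_map_mul_eq hx hy h).symm

theorem decodePrefix_map (hφ : IsSolidCode φ) (a : FreeMonoid α) : hφ.decodePrefix (φ a) = a := by
  simpa using hφ.decodePrefix_eq a hφ.noCodePrefix_one

theorem decodePrefix_map_mul (hφ : IsSolidCode φ) (a : FreeMonoid α) (w : FreeMonoid β) :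
    hφ.decodePrefix (φ a * w) = a * hφ.decodePrefix w := by
  obtain ⟨b, x, rfl, hx⟩ := hφ.exists_eq_map_mul w
  rw [hφ.decodePrefix_eq b hx, ← mul_assoc, ← map_mul, hφ.decodePrefix_eq (a * b) hx]

variable {R : Set (FreeMonoid α × FreeMonoid α)}

theorem eq_one_of_length_map (hφ : IsSolidCode φ) {u : FreeMonoid α} (h : (φ u).length = 0) :
    u = 1 := by
  rw [← hφ.decodePrefix_map u, length_eq_zero.1 h, ← map_one φ, hφ.decodePrefix_map]

/-- An occurrence of one side of a relation is a product of codewords; as codewords do not overlap,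
it lies either within the decoded prefix or wholly behind it. -/
theorem word_decodePrefix_eq (hφ : IsSolidCode φ) (hR : IsHomogeneous (imageRel φ R))
    {u v : FreeMonoid β} (h : PresMonoid.word (imageRel φ R) u = PresMonoid.word (imageRel φ R) v) :
    PresMonoid.word R (hφ.decodePrefix u) = PresMonoid.word R (hφ.decodePrefix v) := by
  refine PresMonoid.apply_eq_of_word_eq (F := fun w => PresMonoid.word R (hφ.decodePrefix w)) ?_ h
  rintro _ ⟨r, hr, rfl⟩ s t
  obtain ⟨a, s, rfl, hs⟩ := hφ.exists_eq_map_mul s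
  have hlen : (φ r.1).length = (φ r.2).length := hR _ (Set.mem_image_of_mem _ hr)
  simp only [Prod.map_fst, Prod.map_snd, mul_assoc, hφ.decodePrefix_map_mul, map_mul]
  congr 1
  by_cases hs1 : s = 1
  · simp only [hs1, one_mul, hφ.decodePrefix_map_mul, map_mul, PresMonoid.word_eq_of_mem hr]
  by_cases hr1 : r.1 = 1
  · have hr2 : r.2 = 1 := hφ.eq_one_of_length_map (by rw [← hlen, hr1, map_one, length_one])
    rw [hr1, hr2]
  · have hr2 : r.2 ≠ 1 := fun hr2 =>
      hr1 (hφ.eq_one_of_length_map (by rw [hlen, hr2, map_one, length_one]))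
    have decode_eq_one {u : FreeMonoid α} (hu : u ≠ 1) :
        hφ.decodePrefix (s * (φ u * t)) = 1 := by
      simpa using hφ.decodePrefix_eq 1 (hφ.noCodePrefix_mul hs hs1 hu t)
    rw [decode_eq_one hr1, decode_eq_one hr2]

theorem imageHom_injective (hφ : IsSolidCode φ) (hR : IsHomogeneous (imageRel φ R)) :
    Function.Injective (PresMonoid.imageHom φ R) := by
  intro p q h
  obtain ⟨u, rfl⟩ := PresentedMonoid.surjective_mk p
  obtain ⟨v, rfl⟩ := PresentedMonoid.surjective_mk q
  rw [PresMonoid.imageHom_word, PresMonoid.imageHom_word] at h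
  simpa only [hφ.decodePrefix_map] using hφ.word_decodePrefix_eq hR h

theorem exists_mul_eq_mul (hφ : IsSolidCode φ) (hR : IsHomogeneous (imageRel φ R))
    {p q : FreeMonoid α} {g : FreeMonoid β}
    (h : PresMonoid.word (imageRel φ R) (φ p * g) = PresMonoid.word (imageRel φ R) (g * φ q)) :
    ∃ a, PresMonoid.word R (p * a) = PresMonoid.word R (a * q) := by
  have hlen : (φ p).length = (φ q).length := by
    simpa [length_mul, add_comm] using hR.length_eq h
  have hdecode := hφ.word_decodePrefix_eq hR h
  obtain ⟨a, x, rfl, hx⟩ := hφ.exists_eq_map_mul g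
  rw [hφ.decodePrefix_map_mul, hφ.decodePrefix_eq a hx, mul_assoc, hφ.decodePrefix_map_mul]
    at hdecode
  by_cases hx1 : x = 1
  · exact ⟨a, by rwa [hx1, one_mul, hφ.decodePrefix_map] at hdecode⟩
  by_cases hq : q = 1
  · have hp : p = 1 := hφ.eq_one_of_length_map (by rw [hlen, hq, map_one, length_one])
    exact ⟨1, by rw [hp, hq]⟩
  have hdecode_x : hφ.decodePrefix (x * φ q) = 1 := by
    simpa using hφ.decodePrefix_eq 1 (hφ.noCodePrefix_mul hx hx1 hq 1)
  rw [hdecode_x, mul_one] at hdecode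
  have hlen_map := hR.length_eq (by
    simpa only [PresMonoid.imageHom_word] using congrArg (PresMonoid.imageHom φ R) hdecode)
  rw [map_mul, length_mul, Nat.add_eq_right] at hlen_map
  exact absurd (hφ.eq_one_of_length_map (hlen ▸ hlen_map)) hq

theorem oConj_imageHom_iff (hφ : IsSolidCode φ) (hR : IsHomogeneous (imageRel φ R))
    (p q : PresMonoid R) :
    OConj (PresMonoid.imageHom φ R p) (PresMonoid.imageHom φ R q) ↔ OConj p q := by
  refine ⟨?_, OConj.map _⟩
  rintro ⟨g, k, hg, hk⟩
  obtain ⟨u, rfl⟩ := PresentedMonoid.surjective_mk p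
  obtain ⟨v, rfl⟩ := PresentedMonoid.surjective_mk q
  obtain ⟨g, rfl⟩ := PresentedMonoid.surjective_mk g
  obtain ⟨k, rfl⟩ := PresentedMonoid.surjective_mk k
  rw [PresMonoid.imageHom_word, PresMonoid.imageHom_word, ← map_mul, ← map_mul] at hg hk
  obtain ⟨a, ha⟩ := hφ.exists_mul_eq_mul hR hg
  obtain ⟨b, hb⟩ := hφ.exists_mul_eq_mul hR hk.symm
  rw [map_mul, map_mul] at ha hb
  exact ⟨_, _, ha, hb.symm⟩

end IsSolidCode

end SolidCodes

section Encode

variable {n : ℕ} {j k : Fin n}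

/-- The codeword `x² yᵏ⁺¹ x yⁿ⁻ᵏ` of a letter, as a list of letters. -/
def codeword (n : ℕ) (k : Fin n) : List (Fin 2) :=
  0 :: 0 :: (List.replicate ((k : ℕ) + 1) 1 ++ 0 :: List.replicate (n - (k : ℕ)) 1)

theorem toList_encode_of (k : Fin n) : toList (encode n (of k)) = codeword n k := by
  simp [encode, letterX, letterY, toList_mul, toList_of_pow, codeword, List.replicate_succ]

theorem count_codeword (k : Fin n) (a : Fin 2) :
    (codeword n k).count a = if a = 0 then 3 else n + 1 := by
  have := k.isLt
  fin_cases a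
  · simp [codeword, List.count_replicate]
  · simp [codeword]
    lia

theorem count_toList_encode (u : FreeMonoid (Fin n)) (a : Fin 2) :
    (toList (encode n u)).count a = u.length * if a = 0 then 3 else n + 1 := by
  induction u using FreeMonoid.inductionOn' with
  | one => simp
  | of_mul k u ih =>
    rw [map_mul, toList_mul, List.count_append, ih, toList_encode_of, count_codeword, length_mul,
      length_of, add_mul, one_mul]

theorem isMultihomogeneous_encodeRel {R : Set (FreeMonoid (Fin n) × FreeMonoid (Fin n))}
    (hR : IsHomogeneous R) : IsMultihomogeneous (encodeRel R) := by
  rintro _ ⟨r, hr, rfl⟩ a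
  have hlen : r.1.length = r.2.length := hR r hr
  rw [count_toList_encode, count_toList_encode, hlen]

theorem replicate_one_append_zero_inj {a b : ℕ} {s t : List (Fin 2)}
    (h : List.replicate a 1 ++ 0 :: s = List.replicate b 1 ++ 0 :: t) : a = b := by
  have := congrArg (List.idxOf 0) h
  simpa [List.idxOf_append, List.mem_replicate] using this

theorem isChain_replicate_one_append {a : ℕ} {l : List (Fin 2)} :
    (List.replicate a 1 ++ l).IsChain (fun x y => x ≠ 0 ∨ y ≠ 0) ↔
      l.IsChain (fun x y => x ≠ 0 ∨ y ≠ 0) := by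
  induction a with
  | zero => simp
  | succ a ih => simp [List.replicate_succ, List.isChain_cons, ih]

theorem exists_codeword_eq_append_one (j : Fin n) : ∃ l, codeword n j = l ++ [1] :=
  ⟨0 :: 0 :: (List.replicate ((j : ℕ) + 1) 1 ++ 0 :: List.replicate (n - j - 1) 1), by
    simp [codeword, ← List.replicate_succ', show n - (j : ℕ) - 1 + 1 = n - j by lia]⟩

theorem codeword_ne_append_zero {s : List (Fin 2)} : codeword n j ≠ s ++ [0] := by
  obtain ⟨l, hl⟩ := exists_codeword_eq_append_one j
  rw [hl]
  exact fun h => absurd (List.append_inj_right' h rfl) (by decide)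

theorem isChain_tail_codeword (j : Fin n) :
    (codeword n j).tail.IsChain (fun x y => x ≠ 0 ∨ y ≠ 0) := by
  obtain ⟨m, hm⟩ : ∃ m, n - (j : ℕ) = m + 1 := ⟨n - j - 1, by lia⟩
  rw [codeword, List.tail_cons, List.isChain_cons, isChain_replicate_one_append, List.isChain_cons,
    hm, ← List.append_nil (List.replicate (m + 1) 1), isChain_replicate_one_append]
  simp [List.replicate_succ]

theorem eq_nil_of_codeword_eq_append {s t : List (Fin 2)} (h : codeword n j = s ++ 0 :: 0 :: t) :
    s = [] := by
  cases s with
  | nil => rfl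
  | cons a s =>
    have hchain := isChain_tail_codeword j
    rw [h, List.cons_append, List.tail_cons] at hchain
    simpa using (List.isChain_append.1 hchain).2.1

/-- Each codeword begins with `xx`, and `xx` occurs nowhere else inside a codeword, which moreover
does not end in `x`. -/
theorem isSolidCode_encode (n : ℕ) : IsSolidCode (encode n) where
  ne_one k h := by simpa [toList_encode_of, codeword] using congrArg toList h
  eq_of_mul_eq {j k s t} h := by
    have hlist := congrArg toList h
    simp only [toList_mul, toList_encode_of, codeword, List.cons_append, List.append_assoc,
      List.cons.injEq, true_and] at hlist
    exact Fin.ext (Nat.succ_injective (replicate_one_append_zero_inj hlist))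
  exists_eq_mul {j k s t x} hs h := by
    have hlist : toList s ++ (toList (encode n (of k)) ++ toList t) =
      toList (encode n (of j)) ++ toList x := congrArg toList h
    rcases List.append_eq_append_iff.1 hlist with ⟨m, hj, hk⟩ | ⟨m, hs', -⟩
    · rw [toList_encode_of] at hj hk
      match m, hk with
      | [], _ => exact ⟨1, toList.injective (by simp [toList_encode_of, hj])⟩
      | [a], hk =>
        obtain rfl : 0 = a := (List.cons.inj hk).1
        exact absurd hj codeword_ne_append_zero
      | a :: b :: m, hk =>
        simp only [codeword, List.cons_append, List.cons.injEq] at hk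
        obtain ⟨rfl, rfl, -⟩ := hk
        exact absurd (eq_nil_of_codeword_eq_append hj) hs
    · exact ⟨ofList m, toList.injective hs'⟩

end Encode

section Reductions

variable {α β : Type*} [Primcodable α] [Primcodable β]

theorem primrec_replicate (a : α) : Primrec fun n : ℕ => List.replicate n a :=
  (Primrec.list_map Primrec.list_range (Primrec.const a).to₂).of_eq fun n => by simp

theorem primrec_toList_hom [Finite α] (φ : FreeMonoid α →* FreeMonoid β) :
    Primrec fun w : List α => toList (φ (ofList w)) :=
  (Primrec.list_flatMap Primrec.id
    ((Primrec.dom_finite fun a => toList (φ (of a))).comp Primrec.snd).to₂).of_eq fun w =>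
      (toList_hom_ofList φ w).symm

theorem OConjDecidable.of_imageRel [Finite α] {φ : FreeMonoid α →* FreeMonoid β}
    {R : Set (FreeMonoid α × FreeMonoid α)} (hdec : OConjDecidable (imageRel φ R))
    (h : ∀ p q, OConj (PresMonoid.imageHom φ R p) (PresMonoid.imageHom φ R q) ↔ OConj p q) :
    OConjDecidable R := by
  have hφ := primrec_toList_hom φ
  refine ComputablePred.computable_of_manyOneReducible
    ⟨fun w => (toList (φ (ofList w.1)), toList (φ (ofList w.2))),
      ((hφ.comp Primrec.fst).pair (hφ.comp Primrec.snd)).to_comp, fun w => ?_⟩ hdec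
  rw [ofList_toList, ofList_toList, ← PresMonoid.imageHom_word, ← PresMonoid.imageHom_word, h]

end Reductions

section ChangeOfAlphabet

variable {α β M : Type*} [Monoid M] {R : Set (FreeMonoid α × FreeMonoid α)} {T : Set α}
  {e : α → β} {u v : FreeMonoid α}

theorem hom_eq_of_eqOn_letters {f g : FreeMonoid α →* M} (h : ∀ a ∈ T, f (of a) = g (of a))
    (hu : ∀ a ∈ u, a ∈ T) : f u = g u := by
  induction u using FreeMonoid.inductionOn' with
  | one => rw [map_one, map_one]
  | of_mul a u ih =>
    rw [map_mul, map_mul, h a (hu a (mem_mul.2 (.inl mem_of_self))),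
      ih fun b hb => hu b (mem_mul.2 (.inr hb))]

theorem endHom_one_apply {S : Type*} (f : M →* Function.End S) (s : S) : f 1 s = s :=
  congrFun (map_one f) s

theorem endHom_mul_apply {S : Type*} (f : M →* Function.End S) (x y : M) (s : S) :
    f (x * y) s = f x (f y s) :=
  congrFun (map_mul f x y) s

namespace PresMonoid

theorem exists_retraction_imageHom_map (he : T.InjOn e)
    (hR : ∀ r ∈ R, (∀ a ∈ r.1, a ∈ T) ∧ ∀ a ∈ r.2, a ∈ T) :
    ∃ D : PresMonoid (imageRel (map e) R) →* PresMonoid R,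
      ∀ u : FreeMonoid α, (∀ a ∈ u, a ∈ T) → D (imageHom (map e) R (word R u)) = word R u := by
  let d : FreeMonoid β →* PresMonoid R :=
    FreeMonoid.lift (Function.extend (T.domRestrict e) (fun a => word R (of (a : α))) 1)
  have hd {u : FreeMonoid α} (hu : ∀ a ∈ u, a ∈ T) : d (map e u) = word R u :=
    hom_eq_of_eqOn_letters (f := d.comp (map e)) (fun a ha => by
      simpa [d] using (Set.injOn_iff_injective.1 he).extend_apply _ _ (⟨a, ha⟩ : T)) hu
  have hrel : ∀ r ∈ imageRel (map e) R, d r.1 = d r.2 := by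
    rintro _ ⟨r, hr, rfl⟩
    exact (hd (hR r hr).1).trans ((word_eq_of_mem hr).trans (hd (hR r hr).2).symm)
  exact ⟨liftHom d hrel, fun u hu => by rw [imageHom_word, liftHom_word, hd hu]⟩

theorem word_map_eq_iff (he : T.InjOn e) (hR : ∀ r ∈ R, (∀ a ∈ r.1, a ∈ T) ∧ ∀ a ∈ r.2, a ∈ T)
    (hu : ∀ a ∈ u, a ∈ T) (hv : ∀ a ∈ v, a ∈ T) :
    word (imageRel (map e) R) (map e u) = word (imageRel (map e) R) (map e v) ↔
      word R u = word R v := by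
  obtain ⟨D, hD⟩ := exists_retraction_imageHom_map he hR
  rw [← imageHom_word, ← imageHom_word]
  refine ⟨fun h => ?_, congrArg _⟩
  rw [← hD u hu, h, hD v hv]

theorem oConj_imageHom_map_iff (he : Function.Injective e) (p q : PresMonoid R) :
    OConj (imageHom (map e) R p) (imageHom (map e) R q) ↔ OConj p q := by
  obtain ⟨D, hD⟩ := exists_retraction_imageHom_map (R := R) (T := Set.univ) he.injOn (by simp)
  refine ⟨fun h => ?_, OConj.map _⟩
  obtain ⟨u, rfl⟩ := PresentedMonoid.surjective_mk p
  obtain ⟨v, rfl⟩ := PresentedMonoid.surjective_mk q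
  have := h.map D
  rwa [hD u (by simp), hD v (by simp)] at this

theorem exists_map_fin_word_eq_iff (hR : R.Finite) {S : Set α} (hS : S.Finite) :
    ∃ (n : ℕ) (e : α → Fin n), ∀ u v : FreeMonoid α, (∀ a ∈ u, a ∈ S) → (∀ a ∈ v, a ∈ S) →
      (word (imageRel (map e) R) (map e u) = word (imageRel (map e) R) (map e v) ↔
        word R u = word R v) := by
  let letters (u : FreeMonoid α) : Set α := {a | a ∈ u}
  have hfin (u : FreeMonoid α) : (letters u).Finite := (toList u).finite_toSet
  let T := S ∪ ⋃ r ∈ R, letters r.1 ∪ letters r.2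
  have hT : T.Finite := hS.union (hR.biUnion fun r _ => (hfin r.1).union (hfin r.2))
  have hcard : T.encard ≤ (Set.univ : Set (Fin (T.ncard + 1))).encard := by
    simp [hT.cast_ncard_eq.symm]
  obtain ⟨e, -, he⟩ := hT.exists_injOn_of_encard_le hcard
  refine ⟨T.ncard + 1, e, fun u v hu hv => word_map_eq_iff he (fun r hr => ⟨?_, ?_⟩)
    (fun a ha => .inl (hu a ha)) (fun a ha => .inl (hv a ha))⟩
  · exact fun a ha => .inr (Set.mem_biUnion hr (.inl ha))
  · exact fun a ha => .inr (Set.mem_biUnion hr (.inr ha))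

end PresMonoid

end ChangeOfAlphabet

section Padding

variable {α M : Type*} [Monoid M] {R : Set (FreeMonoid α × FreeMonoid α)}

/-- The congruence that identifies a central element `z` with `1`. -/
def centralCon (z : M) (hz : ∀ x, Commute z x) : Con M where
  r x y := ∃ i j : ℕ, x * z ^ i = y * z ^ j
  iseqv := {
    refl := fun _ => ⟨0, 0, rfl⟩
    symm := fun ⟨i, j, h⟩ => ⟨j, i, h.symm⟩
    trans := fun {x y t} ⟨i, j, h⟩ ⟨k, l, h'⟩ => ⟨i + k, l + j, by
      rw [pow_add, ← mul_assoc, h, mul_assoc, ← pow_add, add_comm, pow_add, ← mul_assoc, h',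
        mul_assoc, ← pow_add]⟩ }
  mul' {x x' y y'} := fun ⟨i, j, h⟩ ⟨k, l, h'⟩ => ⟨i + k, j + l, by
    simp only [pow_add]
    rw [(((hz y).pow_left i).symm).mul_mul_mul_comm, h, h',
      (((hz y').pow_left j).symm).mul_mul_mul_comm]⟩

/-- A central letter, which pads the relations so that they become homogeneous. -/
def space : FreeMonoid (α ⊕ Bool) := of (.inr true)

/-- A letter that occurs in no relation of `R`.  In a product it separates words over `α`, which
makes `o`-conjugacy of elements that begin with it as fine as equality. -/
def marker : FreeMonoid (α ⊕ Bool) := of (.inr false)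

/-- The homogeneous relations obtained from `R` by padding each side with central letters. -/
def paddedRel (R : Set (FreeMonoid α × FreeMonoid α)) :
    Set (FreeMonoid (α ⊕ Bool) × FreeMonoid (α ⊕ Bool)) :=
  (fun r => (map .inl r.1 * space ^ r.2.length, map .inl r.2 * space ^ r.1.length)) '' R ∪
    Set.range fun a => (space * of a, of a * space)

theorem finite_paddedRel [Finite α] (hR : R.Finite) : (paddedRel R).Finite :=
  (hR.image _).union (Set.finite_range _)

theorem length_map_inl_mul_space_pow (u : FreeMonoid α) (k : ℕ) :
    (map Sum.inl u * space ^ k : FreeMonoid (α ⊕ Bool)).length = u.length + k := by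
  simp [length, space, toList_mul, toList_of_pow, toList_map]

theorem isHomogeneous_paddedRel (R : Set (FreeMonoid α × FreeMonoid α)) :
    IsHomogeneous (paddedRel R) := by
  rintro _ (⟨r, -, rfl⟩ | ⟨a, rfl⟩)
  · change length _ = length _
    rw [length_map_inl_mul_space_pow, length_map_inl_mul_space_pow, add_comm]
  · exact add_comm 1 1

/-- The word `u` behind a marker, padded by as many spaces as `v` is long: then `paddedWord u v` and
`paddedWord v u` have the same length. -/
def paddedWord (u v : FreeMonoid α) : FreeMonoid (α ⊕ Bool) :=
  marker * (map .inl u * space ^ v.length)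

namespace PresMonoid

theorem commute_space (x : PresMonoid (paddedRel R)) : Commute (word (paddedRel R) space) x := by
  obtain ⟨u, rfl⟩ := PresentedMonoid.surjective_mk x
  induction u using FreeMonoid.inductionOn' with
  | one => exact Commute.one_right _
  | of_mul a u ih =>
    have ha : Commute (word (paddedRel R) space) (word (paddedRel R) (of a)) :=
      word_eq_of_mem (R := paddedRel R) (.inr ⟨a, rfl⟩)
    rw [map_mul]
    exact ha.mul_right ih

theorem exists_padded_eq {u v : FreeMonoid α} (h : word R u = word R v) :
    ∃ i, word (paddedRel R) (map .inl u * space ^ (v.length + i)) =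
      word (paddedRel R) (map .inl v * space ^ (u.length + i)) := by
  let c := centralCon (word (paddedRel R) space) commute_space
  have hc : c (word (paddedRel R) (map .inl u)) (word (paddedRel R) (map .inl v)) := by
    have hrel : ∀ r ∈ R, c.comap _ (map_mul ((word (paddedRel R)).comp (map .inl))) r.1 r.2 :=
      fun r hr => ⟨r.2.length, r.1.length, by
        simpa using word_eq_of_mem (R := paddedRel R) (.inl ⟨r, hr, rfl⟩)⟩
    exact con_of_word_eq hrel h
  obtain ⟨i, j, hij⟩ := hc
  rw [← map_pow, ← map_pow, ← map_mul, ← map_mul] at hij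
  have hlen := (isHomogeneous_paddedRel R).length_eq hij
  rw [length_map_inl_mul_space_pow, length_map_inl_mul_space_pow] at hlen
  refine ⟨i, ?_⟩
  rw [add_comm, pow_add, ← mul_assoc, map_mul, hij, ← map_mul, mul_assoc, ← pow_add, hlen,
    add_comm j]

/-- The action of the padded monoid on pairs `(m, S)` of an element and a multiset of elements: a
letter of `α` multiplies the element `m`, the marker moves it into `S`, and spaces do nothing. -/
def storeAct (R : Set (FreeMonoid α × FreeMonoid α)) :
    FreeMonoid (α ⊕ Bool) →* Function.End (PresMonoid R × Multiset (PresMonoid R)) :=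
  FreeMonoid.lift fun
    | .inl a => fun s => (word R (of a) * s.1, s.2)
    | .inr true => id
    | .inr false => fun s => (1, s.1 ::ₘ s.2)

theorem storeAct_map_inl (u : FreeMonoid α) (s : PresMonoid R × Multiset (PresMonoid R)) :
    storeAct R (map .inl u) s = (word R u * s.1, s.2) := by
  induction u using FreeMonoid.inductionOn' with
  | one => simp [endHom_one_apply]
  | of_mul a u ih =>
    rw [map_mul, endHom_mul_apply, ih, map_mul, mul_assoc]
    rfl

theorem storeAct_space_pow (k : ℕ) : storeAct R (space ^ k) = 1 := by
  rw [map_pow]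
  exact one_pow k

theorem storeAct_paddedWord (u v : FreeMonoid α) (s : PresMonoid R × Multiset (PresMonoid R)) :
    storeAct R (paddedWord u v) s = (1, word R u * s.1 ::ₘ s.2) := by
  rw [paddedWord, endHom_mul_apply, map_mul, storeAct_space_pow, mul_one, storeAct_map_inl]
  rfl

theorem storeAct_cons (u : FreeMonoid (α ⊕ Bool)) (m p : PresMonoid R)
    (S : Multiset (PresMonoid R)) :
    storeAct R u (m, p ::ₘ S) = ((storeAct R u (m, S)).1, p ::ₘ (storeAct R u (m, S)).2) := by
  induction u using FreeMonoid.inductionOn' with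
  | one => rfl
  | of_mul a u ih =>
    rw [endHom_mul_apply, endHom_mul_apply, ih]
    rcases a with a | _ | _
    · rfl
    · exact congrArg (Prod.mk 1) (Multiset.cons_swap _ _ _)
    · rfl

theorem storeAct_eq_of_mem {r : FreeMonoid (α ⊕ Bool) × FreeMonoid (α ⊕ Bool)}
    (hr : r ∈ paddedRel R) : storeAct R r.1 = storeAct R r.2 := by
  obtain ⟨r, hr, rfl⟩ | ⟨a, rfl⟩ := hr
  · funext s
    simp only [map_mul, storeAct_space_pow, mul_one, storeAct_map_inl, word_eq_of_mem hr]
  · rw [map_mul, map_mul]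
    rfl

/-- If `p * g = g * q` for `p = paddedWord u v` and `q = paddedWord v u`, then `p * g` stores what
`g` stores together with `u`, whereas `g * q` stores what `g` stores together with `v`. -/
theorem oConj_paddedWord_iff {u v : FreeMonoid α} :
    OConj (word (paddedRel R) (paddedWord u v)) (word (paddedRel R) (paddedWord v u)) ↔
      word R u = word R v := by
  constructor
  · rintro ⟨g, -, hg, -⟩
    obtain ⟨g, rfl⟩ := PresentedMonoid.surjective_mk g
    rw [← map_mul, ← map_mul] at hg
    have hact := congrArg (liftHom (storeAct R) fun _ => storeAct_eq_of_mem) hg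
    have hstore := congrFun hact (1, 0)
    simp only [liftHom_word, endHom_mul_apply, storeAct_paddedWord, mul_one] at hstore
    rw [storeAct_cons] at hstore
    obtain ⟨hg_one, hmultiset⟩ := Prod.mk.inj hstore
    rwa [← hg_one, mul_one, Multiset.cons_inj_left] at hmultiset
  · intro h
    obtain ⟨i, hi⟩ := exists_padded_eq h
    have hspace := (commute_space (R := R) (word _ (paddedWord v u))).pow_left i
    have heq : word (paddedRel R) (paddedWord u v) * word _ space ^ i =
        word _ space ^ i * word _ (paddedWord v u) := by
      rw [hspace.eq]
      simpa only [paddedWord, pow_add, map_mul, map_pow, mul_assoc] using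
        congrArg (word (paddedRel R) marker * ·) hi
    have hspace' := (commute_space (R := R) (word _ (paddedWord u v))).pow_left i
    exact ⟨_, _, heq, by rw [hspace'.eq, heq, hspace.eq]⟩

end PresMonoid

/-- The word problem of a presentation is decidable if there is an algorithm that, given two words
over the alphabet, decides whether they represent the same element. -/
def WordProblemDecidable [Primcodable α] (R : Set (FreeMonoid α × FreeMonoid α)) : Prop :=
  ComputablePred fun w : List α × List α =>
    PresMonoid.word R (ofList w.1) = PresMonoid.word R (ofList w.2)

theorem toList_paddedWord (u v : List α) :
    toList (paddedWord (ofList u) (ofList v)) =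
      .inr false :: (u.map .inl ++ v.map fun _ => .inr true) := by
  simp [paddedWord, marker, space, toList_mul, toList_of_pow, toList_map, length]

theorem OConjDecidable.wordProblemDecidable [Primcodable α] (h : OConjDecidable (paddedRel R)) :
    WordProblemDecidable R := by
  have hpad : Primrec₂ fun u v : List α => toList (paddedWord (ofList u) (ofList v)) :=
    Primrec₂.of_eq
      (Primrec.list_cons.comp₂ (Primrec₂.const (.inr false))
        (Primrec.list_append.comp₂
          (Primrec.list_map Primrec.fst (Primrec.sumInl.comp Primrec.snd).to₂).to₂
          (Primrec.list_map Primrec.snd (Primrec.const (.inr true)).to₂).to₂))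
      fun u v => (toList_paddedWord u v).symm
  refine ComputablePred.computable_of_manyOneReducible
    ⟨fun w => (toList (paddedWord (ofList w.1) (ofList w.2)),
      toList (paddedWord (ofList w.2) (ofList w.1))),
      ((hpad.comp Primrec.fst Primrec.snd).pair (hpad.comp Primrec.snd Primrec.fst)).to_comp,
      fun w => ?_⟩ h
  rw [ofList_toList, ofList_toList, PresMonoid.oConj_paddedWord_iff]

end Padding

section Evaluation

open Turing.ToPartrec (Code)

/-- The letters that write lists of numbers: `nil` stands for the empty list, `zero` puts a `0` in
front of a list, and `succ` increments the head of a list, with `[1]` as the result for `[]`. -/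
inductive StackSymbol
  | succ | zero | nil

/-- The letters that operate on a stack of lists.  The operation `second s` applies the symbol `s`
below the topmost list, `consHead` replaces the two topmost lists `u` and `v` by `u.headI :: v`,
`code c` runs `c` on the topmost list, and `test f` completes one round of the loop `f.fix`. -/
inductive StackOp
  | second (s : StackSymbol) | dup | swap | drop | consHead | code (c : Code) | test (f : Code)

/-- Words of symbols and operations.  They act on stacks of lists from the left, so that the last
letter acts first. -/
abbrev StackWord : Type := FreeMonoid (StackSymbol ⊕ StackOp)

namespace StackWord

open StackSymbol StackOp

/-- The word that consists of one symbol. -/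
def sym (s : StackSymbol) : StackWord := of (.inl s)

/-- The word that consists of one operation. -/
def op (o : StackOp) : StackWord := of (.inr o)

/-- The word that replaces the topmost list `v` of a stack by `v.headI :: v.tail`.  As `succ` turns
both `[]` and `[0]` into `[1]`, a program that decrements has to normalize `[]` to `[0]`. -/
def pad : StackWord := op consHead * (op swap * (op (code .tail) * op dup))

/-- The word into which `op o * sym s` may be rewritten. -/
def reduct : StackOp → StackSymbol → StackWord
  | second p, nil => sym nil * sym p
  | second p, s => sym s * op (second p)
  | dup, nil => sym nil * sym nil
  | dup, s => sym s * (op (second s) * op dup)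
  | swap, nil => op (second nil)
  | swap, s => op (second s) * op swap
  | drop, nil => 1
  | drop, _ => op drop
  | consHead, succ => sym succ * op consHead
  | consHead, zero => sym zero * op drop
  | consHead, nil => sym zero
  | code .tail, succ => op (code .tail)
  | code .tail, zero => 1
  | code .tail, nil => sym nil
  | code .zero', s => sym zero * sym s
  | code .succ, succ => sym succ * op (code .succ)
  | code .succ, zero => sym succ * (sym zero * (sym nil * op drop))
  | code .succ, nil => sym succ * (sym zero * sym nil)
  | code (.cons f g), s =>
    op consHead * (op swap * (op (code g) * (op swap * (op (code f) * (op dup * sym s)))))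
  | code (.comp f g), s => op (code f) * (op (code g) * sym s)
  | code (.case f _), zero => op (code f)
  | code (.case _ g), succ => op (code g) * pad
  | code (.case f _), nil => op (code f) * sym nil
  | code (.fix f), s => op (test f) * (op (code f) * sym s)
  | test _, zero => 1
  | test f, succ => op (code f.fix) * op (code .tail)
  | test _, nil => sym nil

/-- The word that pushes a list on a stack. -/
def push : List ℕ → StackWord
  | [] => sym nil
  | n :: v => sym succ ^ n * (sym zero * push v)

theorem push_induction {P : List ℕ → Prop} (nil : P []) (zero : ∀ v, P v → P (0 :: v))
    (succ : ∀ n v, P (n :: v) → P ((n + 1) :: v)) (v : List ℕ) : P v := by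
  induction v with
  | nil => exact nil
  | cons n v ih =>
    induction n with
    | zero => exact zero v ih
    | succ n ihn => exact succ n v ihn

section Derivations

variable {X : Type*} [MulAction StackWord X]

theorem push_nil_smul (x : X) : push [] • x = sym nil • x := rfl

theorem push_zero_cons_smul (v : List ℕ) (x : X) : push (0 :: v) • x = sym zero • push v • x := by
  rw [push, pow_zero, one_mul, mul_smul]

theorem push_succ_cons_smul (n : ℕ) (v : List ℕ) (x : X) :
    push ((n + 1) :: v) • x = sym succ • push (n :: v) • x := by
  rw [push, pow_succ', mul_assoc, mul_smul]
  rfl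

theorem exists_push_smul_eq_sym_smul (v : List ℕ) (x : X) :
    ∃ (s : StackSymbol) (y : X), push v • x = sym s • y := by
  induction v using push_induction with
  | nil => exact ⟨_, _, push_nil_smul x⟩
  | zero v => exact ⟨_, _, push_zero_cons_smul v x⟩
  | succ n v => exact ⟨_, _, push_succ_cons_smul n v x⟩

variable (X) in
/-- The rewrite rules of the operation `o` are valid for the action of words on `X`. -/
def Obeys (o : StackOp) : Prop :=
  ∀ (s : StackSymbol) (x : X), op o • sym s • x = reduct o s • x

theorem Obeys.smul_push {o : StackOp} (h : Obeys X o) {u : StackWord}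
    (hu : ∀ s, reduct o s = u * sym s) (v : List ℕ) (x : X) :
    op o • push v • x = u • push v • x := by
  obtain ⟨s, y, hv⟩ := exists_push_smul_eq_sym_smul v x
  rw [hv, h, hu, mul_smul]

theorem second_smul_push {s : StackSymbol} (h : Obeys X (second s)) (v : List ℕ) (x : X) :
    op (second s) • push v • x = push v • sym s • x := by
  induction v using push_induction with
  | nil => rw [push_nil_smul, push_nil_smul, h, reduct, mul_smul]
  | zero v ih => simp only [push_zero_cons_smul, h zero, reduct, mul_smul, ih]
  | succ n v ih => simp only [push_succ_cons_smul, h succ, reduct, mul_smul, ih]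

theorem dup_smul_push (hdup : Obeys X dup) (hsecond : ∀ s, Obeys X (second s)) (v : List ℕ)
    (x : X) : op dup • push v • x = push v • push v • x := by
  have h (s : StackSymbol) := second_smul_push (hsecond s)
  induction v using push_induction with
  | nil => simp only [push_nil_smul, hdup nil, reduct, mul_smul]
  | zero v ih => simp only [push_zero_cons_smul, hdup zero, reduct, mul_smul, ih, h]
  | succ n v ih => simp only [push_succ_cons_smul, hdup succ, reduct, mul_smul, ih, h]

theorem swap_smul_push (hswap : Obeys X swap) (hsecond : ∀ s, Obeys X (second s)) (u v : List ℕ)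
    (x : X) : op swap • push u • push v • x = push v • push u • x := by
  have h (s : StackSymbol) := second_smul_push (hsecond s)
  induction u using push_induction with
  | nil => simp only [push_nil_smul, hswap nil, reduct, h]
  | zero u ih => simp only [push_zero_cons_smul, hswap zero, reduct, mul_smul, ih, h]
  | succ n u ih => simp only [push_succ_cons_smul, hswap succ, reduct, mul_smul, ih, h]

theorem drop_smul_push (h : Obeys X drop) (v : List ℕ) (x : X) : op drop • push v • x = x := by
  induction v using push_induction with
  | nil => rw [push_nil_smul, h, reduct, one_smul]
  | zero v ih => simp only [push_zero_cons_smul, h zero, reduct, ih]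
  | succ n v ih => simp only [push_succ_cons_smul, h succ, reduct, ih]

theorem consHead_smul_push (hcons : Obeys X consHead) (hdrop : Obeys X drop) (u v : List ℕ)
    (x : X) : op consHead • push u • push v • x = push (u.headI :: v) • x := by
  induction u using push_induction with
  | nil => rw [push_nil_smul, hcons, reduct, ← push_zero_cons_smul]; rfl
  | zero u =>
    rw [push_zero_cons_smul, hcons, reduct, mul_smul, drop_smul_push hdrop, ← push_zero_cons_smul]
    rfl
  | succ n u ih =>
    rw [push_succ_cons_smul, hcons, reduct, mul_smul, ih, ← push_succ_cons_smul]
    rfl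

theorem tail_smul_push (h : Obeys X (code .tail)) (v : List ℕ) (x : X) :
    op (code .tail) • push v • x = push v.tail • x := by
  induction v using push_induction with
  | nil => exact h nil x
  | zero v => rw [push_zero_cons_smul, h, reduct, one_smul, List.tail_cons]
  | succ n v ih => rw [push_succ_cons_smul, h, reduct, ih, List.tail_cons, List.tail_cons]

/-- The operations whose rules every program needs. -/
def stackOps : Set StackOp := {dup, swap, drop, consHead, code .tail} ∪ Set.range second

theorem pad_smul_push (hX : ∀ o ∈ stackOps, Obeys X o) (v : List ℕ) (x : X) :
    pad • push v • x = push (v.headI :: v.tail) • x := by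
  have hsecond (s : StackSymbol) : Obeys X (second s) := hX _ (.inr ⟨s, rfl⟩)
  rw [pad, mul_smul, mul_smul, mul_smul, dup_smul_push (hX dup (by simp [stackOps])) hsecond,
    tail_smul_push (hX (code .tail) (by simp [stackOps])),
    swap_smul_push (hX swap (by simp [stackOps])) hsecond,
    consHead_smul_push (hX consHead (by simp [stackOps])) (hX drop (by simp [stackOps]))]

variable (X) in
/-- The letter of the program `c` rewrites each input on which `c` halts into the output. -/
def Computes (c : Code) : Prop :=
  ∀ ⦃v w : List ℕ⦄, w ∈ c.eval v → ∀ x : X, op (code c) • push v • x = push w • x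

theorem computes_zero' (h : Obeys X (code .zero')) : Computes X .zero' := by
  intro v w hw x
  obtain rfl : w = 0 :: v := by simpa using hw
  rw [h.smul_push (u := sym zero) (fun _ => rfl), push_zero_cons_smul]

theorem computes_tail (h : Obeys X (code .tail)) : Computes X .tail := by
  intro v w hw x
  obtain rfl : w = v.tail := by simpa using hw
  exact tail_smul_push h v x

theorem computes_succ (hsucc : Obeys X (code .succ)) (hdrop : Obeys X drop) :
    Computes X .succ := by
  intro v w hw x
  obtain rfl : w = [v.headI + 1] := by simpa using hw
  clear hw
  induction v using push_induction with
  | nil =>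
    rw [push_nil_smul, hsucc, reduct, push_succ_cons_smul, List.headI_nil]
    simp only [Nat.default_eq_zero, push_zero_cons_smul, push_nil_smul, mul_smul]
  | zero v =>
    rw [push_zero_cons_smul, hsucc, reduct, push_succ_cons_smul, List.headI_cons]
    simp only [push_zero_cons_smul, push_nil_smul, mul_smul, drop_smul_push hdrop]
  | succ n v ih =>
    rw [push_succ_cons_smul, hsucc, reduct, mul_smul, ih, ← push_succ_cons_smul]
    rfl

theorem Computes.cons {f g : Code} (hf : Computes X f) (hg : Computes X g)
    (hX : ∀ o ∈ stackOps, Obeys X o) (h : Obeys X (code (.cons f g))) :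
    Computes X (.cons f g) := by
  intro v w hw x
  obtain ⟨n, hn, l, hl, rfl⟩ : ∃ n ∈ f.eval v, ∃ l ∈ g.eval v, w = n.headI :: l := by
    simpa [Part.bind_eq_bind] using hw
  have hsecond (s : StackSymbol) : Obeys X (second s) := hX _ (.inr ⟨s, rfl⟩)
  have hswap := swap_smul_push (hX swap (by simp [stackOps])) hsecond
  have hreduct (s : StackSymbol) : reduct (code (.cons f g)) s =
      (op consHead * (op swap * (op (code g) * (op swap * (op (code f) * op dup))))) * sym s := rfl
  rw [h.smul_push hreduct]
  simp only [mul_smul]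
  rw [dup_smul_push (hX dup (by simp [stackOps])) hsecond, hf hn, hswap, hg hl, hswap,
    consHead_smul_push (hX consHead (by simp [stackOps])) (hX drop (by simp [stackOps]))]

theorem Computes.comp {f g : Code} (hf : Computes X f) (hg : Computes X g)
    (h : Obeys X (code (.comp f g))) : Computes X (.comp f g) := by
  intro v w hw x
  obtain ⟨u, hu, hw⟩ := Part.mem_bind_iff.1 hw
  rw [h.smul_push (u := op (code f) * op (code g)) fun _ => rfl, mul_smul, hg hu, hf hw]

theorem Computes.case {f g : Code} (hf : Computes X f) (hg : Computes X g)
    (hX : ∀ o ∈ stackOps, Obeys X o) (h : Obeys X (code (.case f g))) :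
    Computes X (.case f g) := by
  intro v w hw x
  rw [Code.case_eval] at hw
  match v, hw with
  | [], hw =>
    rw [push_nil_smul, h, reduct, mul_smul]
    exact hf hw x
  | 0 :: v, hw =>
    rw [push_zero_cons_smul, h, reduct]
    exact hf hw x
  | (n + 1) :: v, hw =>
    rw [push_succ_cons_smul, h, reduct, mul_smul, pad_smul_push hX]
    exact hg hw x

theorem Computes.fix {f : Code} (hf : Computes X f) (htail : Obeys X (code .tail))
    (htest : Obeys X (test f)) (hfix : Obeys X (code f.fix)) : Computes X f.fix := by
  intro v w hw x
  have hround {v u : List ℕ} (hu : u ∈ f.eval v) :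
      op (code f.fix) • push v • x = op (test f) • push u • x := by
    rw [hfix.smul_push (u := op (test f) * op (code f)) fun _ => rfl, mul_smul, hf hu]
  rw [Code.fix_eval] at hw
  refine PFun.fixInduction' hw (fun v hv => ?_) fun v v' _ hv ih => ?_
  · obtain ⟨u, hu, huw⟩ := (Part.mem_map_iff _).1 hv
    rw [hround hu]
    match u, huw with
    | [], huw =>
      obtain rfl : [] = w := by simpa using huw
      exact htest nil x
    | 0 :: u, huw =>
      obtain rfl : u = w := by simpa using huw
      rw [push_zero_cons_smul, htest, reduct, one_smul]
  · obtain ⟨u, hu, huv⟩ := (Part.mem_map_iff _).1 hv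
    rw [hround hu]
    match u, huv with
    | (n + 1) :: u, huv =>
      obtain rfl : u = v' := by simpa using huv
      rw [push_succ_cons_smul, htest, reduct, mul_smul, tail_smul_push htail, List.tail_cons, ih]

/-- The letters of a program and of its subprograms. -/
def codeOps : Code → Set StackOp
  | .zero' => {code .zero'}
  | .succ => {code .succ}
  | .tail => {code .tail}
  | .cons f g => {code (.cons f g)} ∪ (codeOps f ∪ codeOps g)
  | .comp f g => {code (.comp f g)} ∪ (codeOps f ∪ codeOps g)
  | .case f g => {code (.case f g)} ∪ (codeOps f ∪ codeOps g)
  | .fix f => {code f.fix, test f} ∪ codeOps f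

theorem computes_of_obeys (hX : ∀ o ∈ stackOps, Obeys X o) {c : Code}
    (hc : ∀ o ∈ codeOps c, Obeys X o) : Computes X c := by
  induction c with
  | zero' => exact computes_zero' (hc _ rfl)
  | succ => exact computes_succ (hc _ rfl) (hX drop (by simp [stackOps]))
  | tail => exact computes_tail (hc _ rfl)
  | cons f g hf hg =>
    exact (hf fun o ho => hc o (.inr (.inl ho))).cons (hg fun o ho => hc o (.inr (.inr ho))) hX
      (hc _ (.inl rfl))
  | comp f g hf hg =>
    exact (hf fun o ho => hc o (.inr (.inl ho))).comp (hg fun o ho => hc o (.inr (.inr ho)))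
      (hc _ (.inl rfl))
  | case f g hf hg =>
    exact (hf fun o ho => hc o (.inr (.inl ho))).case (hg fun o ho => hc o (.inr (.inr ho))) hX
      (hc _ (.inl rfl))
  | fix f hf =>
    exact (hf fun o ho => hc o (.inr ho)).fix (hX _ (by simp [stackOps])) (hc _ (.inl (.inr rfl)))
      (hc _ (.inl (.inl rfl)))

end Derivations

/-- The bottomless stacks on which the operations act. -/
abbrev Stack : Type := Stream' (List ℕ)

/-- The action of a symbol on a stack. -/
def symFun : StackSymbol → Stack → Stack
  | succ, st => .cons ((st.head.headI + 1) :: st.head.tail) st.tail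
  | zero, st => .cons (0 :: st.head) st.tail
  | nil, st => .cons [] st

/-- The action of an operation on a stack, a partial function because programs need not halt. -/
def opFun : StackOp → Stack → Part Stack
  | second s, st => .some (.cons st.head (symFun s st.tail))
  | dup, st => .some (.cons st.head st)
  | swap, st => .some (.cons st.tail.head (.cons st.head st.tail.tail))
  | drop, st => .some st.tail
  | consHead, st => .some (.cons (st.head.headI :: st.tail.head) st.tail.tail)
  | code c, st => (c.eval st.head).map (.cons · st.tail)
  | test f, st =>
    (if st.head.headI = 0 then .some st.head.tail else f.fix.eval st.head.tail).map
      (.cons · st.tail)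

/-- Words act on partially defined stacks: `Part.none` is the result of a program that does not
halt. -/
instance : MulAction StackWord (Part Stack) :=
  mkMulAction fun l p => p.bind (Sum.elim (fun s st => .some (symFun s st)) opFun l)

theorem sym_smul_some (s : StackSymbol) (st : Stack) :
    sym s • Part.some st = Part.some (symFun s st) := by
  rw [sym, of_smul, Part.bind_some, Sum.elim_inl]

theorem op_smul (o : StackOp) (p : Part Stack) : op o • p = p.bind (opFun o) := by
  rw [op, of_smul]
  rfl

theorem op_smul_some (o : StackOp) (st : Stack) : op o • Part.some st = opFun o st := by
  rw [op_smul, Part.bind_some]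

theorem smul_none (u : StackWord) : u • (Part.none : Part Stack) = Part.none := by
  induction u using FreeMonoid.inductionOn' with
  | one => rw [one_smul]
  | of_mul l u ih => rw [mul_smul, ih, of_smul, Part.bind_none]

theorem push_smul_some (v : List ℕ) (st : Stack) :
    push v • Part.some st = Part.some (.cons v st) := by
  induction v using push_induction with
  | nil => rw [push_nil_smul, sym_smul_some, symFun]
  | zero v ih =>
    rw [push_zero_cons_smul, ih, sym_smul_some, symFun, Stream'.head_cons, Stream'.tail_cons]
  | succ n v ih => rw [push_succ_cons_smul, ih, sym_smul_some]; rfl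

theorem obeys_of_smul_some {o : StackOp}
    (h : ∀ s (st : Stack), op o • Part.some (symFun s st) = reduct o s • Part.some st) :
    Obeys (Part Stack) o := by
  intro s p
  induction p using Part.induction_on with
  | hnone => simp only [smul_none]
  | hsome st => rw [sym_smul_some, h]

theorem eval_fix_eq_bind (f : Code) (v : List ℕ) : f.fix.eval v =
    (f.eval v).bind fun w => if w.headI = 0 then .some w.tail else f.fix.eval w.tail := by
  ext w
  rw [Code.fix_eval]
  refine PFun.mem_fix_iff.trans ?_
  simp only [Part.mem_map_iff, Part.mem_bind_iff]
  constructor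
  · rintro (⟨u, hu, huw⟩ | ⟨u', ⟨u, hu, huu'⟩, hw⟩) <;> refine ⟨u, hu, ?_⟩ <;>
      split_ifs at * <;> simp_all
  · rintro ⟨u, hu, hw⟩
    by_cases h0 : u.headI = 0
    · exact .inl ⟨u, hu, by simp_all⟩
    · exact .inr ⟨u.tail, ⟨u, hu, by simp_all⟩, by simp_all⟩

theorem obeys_code (c : Code) : Obeys (Part Stack) (code c) := by
  refine obeys_of_smul_some fun s st => ?_
  cases c with
  | zero' => rw [reduct, mul_smul, sym_smul_some, sym_smul_some, op_smul_some]; rfl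
  | succ => cases s <;> simp [reduct, mul_smul, sym_smul_some, op_smul_some, opFun, symFun]
  | tail => cases s <;> simp [reduct, sym_smul_some, op_smul_some, opFun, symFun, Stream'.eta]
  | cons f g =>
    simp [reduct, mul_smul, sym_smul_some, op_smul, opFun, ← Part.bind_some_eq_map,
      Part.bind_assoc]
  | comp f g =>
    have heval (v : List ℕ) : (f.comp g).eval v = (g.eval v).bind fun u => f.eval u := rfl
    simp only [reduct, mul_smul, sym_smul_some, op_smul, opFun, ← Part.bind_some_eq_map,
      Part.bind_assoc, heval, Part.bind_some, Stream'.head_cons, Stream'.tail_cons]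
  | case f g =>
    cases s <;> simp [reduct, pad, mul_smul, sym_smul_some, op_smul_some, opFun, symFun]
  | fix f =>
    simp [reduct, mul_smul, sym_smul_some, op_smul, opFun, ← Part.bind_some_eq_map,
      Part.bind_assoc, eval_fix_eq_bind f (symFun s st).head]

theorem obeys_stack (o : StackOp) : Obeys (Part Stack) o := by
  cases o with
  | code c => exact obeys_code c
  | test f =>
    refine obeys_of_smul_some fun s st => ?_
    cases s <;> simp [reduct, mul_smul, op_smul_some, sym_smul_some, opFun, symFun, Stream'.eta]
  | _ =>
    refine obeys_of_smul_some fun s st => ?_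
    cases s <;> simp [reduct, mul_smul, sym_smul_some, op_smul_some, opFun, symFun]

/-- The finite set of relations that evaluates the program `c`: the rewrite rules of its letters and
of the operations that every program needs. -/
def evalRel (c : Code) : Set (StackWord × StackWord) :=
  Set.image2 (fun o s => (op o * sym s, reduct o s)) (stackOps ∪ codeOps c) Set.univ

instance : Finite StackSymbol :=
  Set.finite_univ_iff.1 <| (Set.toFinite {succ, zero, nil}).subset fun s _ => by
    cases s <;> simp

theorem finite_codeOps (c : Code) : (codeOps c).Finite := by
  induction c with
  | zero' | succ | tail => exact Set.finite_singleton _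
  | cons f g hf hg | comp f g hf hg | case f g hf hg =>
    exact (Set.finite_singleton _).union (hf.union hg)
  | fix f hf => exact (Set.toFinite _).union hf

theorem finite_evalRel (c : Code) : (evalRel c).Finite :=
  (((Set.toFinite _).union (Set.finite_range _)).union (finite_codeOps c)).image2 _ Set.finite_univ

theorem word_evalRel_eq_iff (c : Code) (v w : List ℕ) :
    PresMonoid.word (evalRel c) (op (code c) * push v) = PresMonoid.word (evalRel c) (push w) ↔
      w ∈ c.eval v := by
  constructor
  · intro h
    let base : Stack := .const []
    have hrel : ∀ r ∈ evalRel c, ∀ x y,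
        (x * r.1 * y) • Part.some base = (x * r.2 * y) • Part.some base := by
      rintro _ ⟨o, -, s, -, rfl⟩ x y
      simp only [mul_smul, obeys_stack o s]
    have hact : (op (code c) * push v) • Part.some base = push w • Part.some base :=
      PresMonoid.apply_eq_of_word_eq (F := (· • Part.some base)) hrel h
    rw [mul_smul, push_smul_some, push_smul_some, op_smul_some, Part.eq_some_iff, opFun] at hact
    obtain ⟨u, hu, huw⟩ := (Part.mem_map_iff _).1 hact
    exact Stream'.cons_injective_left base huw ▸ hu
  · intro h
    let _ : MulAction StackWord (PresMonoid (evalRel c)) :=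
      .compHom _ (PresMonoid.word (evalRel c))
    have hsmul (u : StackWord) (x : PresMonoid (evalRel c)) :
        u • x = PresMonoid.word (evalRel c) u * x := rfl
    have hX : ∀ o ∈ stackOps ∪ codeOps c, Obeys (PresMonoid (evalRel c)) o := by
      intro o ho s x
      have hword : PresMonoid.word (evalRel c) (op o * sym s) = PresMonoid.word _ (reduct o s) :=
        PresMonoid.word_eq_of_mem (R := evalRel c) ⟨o, ho, s, trivial, rfl⟩
      rw [← mul_smul, hsmul, hsmul, hword]
    have hcode := computes_of_obeys (fun o ho => hX o (.inl ho)) (fun o ho => hX o (.inr ho)) h 1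
    rwa [← mul_smul, hsmul, hsmul, mul_one, mul_one] at hcode

theorem push_singleton (n : ℕ) :
    push [n] = ofList (List.replicate n (.inl succ) ++ [.inl zero, .inl nil]) :=
  toList.injective <| by simp [push, sym, toList_of_pow, toList_mul]

end StackWord

/-- By the halting problem: `c` returns `0` on the codes of the programs that halt on `0`. -/
theorem exists_code_not_computablePred :
    ∃ c : Code, ¬ ComputablePred fun m : ℕ => [0] ∈ c.eval [m] := by
  have hp : Partrec fun m : ℕ =>
      (Nat.Partrec.Code.eval (Denumerable.ofNat Nat.Partrec.Code m) 0).map fun _ => 0 :=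
    (Nat.Partrec.Code.eval_part.comp (Computable.ofNat Nat.Partrec.Code) (Computable.const 0)).map
      (Computable.const 0).to₂
  obtain ⟨c, hc⟩ := Code.exists_code (Nat.Partrec'.part_iff₁.2 hp)
  refine ⟨c, fun h => ComputablePred.halting_problem 0
    (ComputablePred.computable_of_manyOneReducible ⟨Encodable.encode, Computable.encode, ?_⟩ h)⟩
  intro d
  have hcd := hc (Encodable.encode d ::ᵥ List.Vector.nil)
  rw [List.Vector.head_cons, Denumerable.ofNat_encode] at hcd
  change c.eval [Encodable.encode d] = _ at hcd
  rw [hcd]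
  simp [Part.dom_iff_mem, pure]

open StackWord StackSymbol StackOp in
theorem exists_not_wordProblemDecidable :
    ∃ (n : ℕ) (R : Set (FreeMonoid (Fin n) × FreeMonoid (Fin n))),
      R.Finite ∧ ¬ WordProblemDecidable R := by
  obtain ⟨c, hc⟩ := exists_code_not_computablePred
  let letters : Set (StackSymbol ⊕ StackOp) := {.inr (code c), .inl succ, .inl zero, .inl nil}
  obtain ⟨n, e, he⟩ :=
    PresMonoid.exists_map_fin_word_eq_iff (finite_evalRel c) (Set.toFinite letters)
  refine ⟨n, imageRel (map e) (evalRel c), (finite_evalRel c).image _, fun h => hc ?_⟩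
  let numeral (m : ℕ) : List (StackSymbol ⊕ StackOp) :=
    List.replicate m (.inl succ) ++ [.inl zero, .inl nil]
  let input (m : ℕ) : List (StackSymbol ⊕ StackOp) := .inr (code c) :: numeral m
  have hnumeral_letters (m : ℕ) : ∀ a ∈ numeral m, a ∈ letters := by
    simp +contextual [numeral, letters, or_imp]
  have hinput_letters (m : ℕ) : ∀ a ∈ input m, a ∈ letters :=
    List.forall_mem_cons.2 ⟨.inl rfl, hnumeral_letters m⟩
  have hiff (m : ℕ) : PresMonoid.word (imageRel (map e) (evalRel c)) (map e (ofList (input m))) =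
      PresMonoid.word (imageRel (map e) (evalRel c)) (map e (ofList (numeral 0))) ↔
        [0] ∈ c.eval [m] := by
    refine (he _ (ofList _) (hinput_letters m) (hnumeral_letters 0)).trans ?_
    rw [← word_evalRel_eq_iff, push_singleton, push_singleton]
    rfl
  have hcomputable : Computable fun m => ((input m).map e, (numeral 0).map e) := by
    have hinput : Primrec fun m => (input m).map e :=
      (Primrec.list_cons.comp (Primrec.const (e (.inr (code c))))
        (Primrec.list_append.comp (primrec_replicate (e (.inl succ)))
          (Primrec.const [e (.inl zero), e (.inl nil)]))).of_eq fun m => by simp [input, numeral]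
    exact (hinput.pair (Primrec.const _)).to_comp
  exact ComputablePred.computable_of_manyOneReducible
    ⟨_, hcomputable, fun m => (hiff m).symm⟩ h

end Evaluation

theorem IsHomogeneous.imageRel_map {α β : Type*} {R : Set (FreeMonoid α × FreeMonoid α)}
    (hR : IsHomogeneous R) (e : α → β) : IsHomogeneous (imageRel (map e) R) := by
  rintro _ ⟨r, hr, rfl⟩
  simpa only [Prod.map, toList_map, List.length_map] using hR r hr

theorem exists_homogeneous_not_oConjDecidable :
    ∃ (n : ℕ) (R : Set (FreeMonoid (Fin n) × FreeMonoid (Fin n))),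
      R.Finite ∧ IsHomogeneous R ∧ ¬ OConjDecidable R := by
  obtain ⟨n, R, hR, hdec⟩ := exists_not_wordProblemDecidable
  let e : Fin n ⊕ Bool ≃ Fin _ := Fintype.equivFin _
  refine ⟨_, imageRel (map e) (paddedRel R), (finite_paddedRel hR).image _,
    (isHomogeneous_paddedRel R).imageRel_map e, fun h => hdec ?_⟩
  exact (h.of_imageRel (PresMonoid.oConj_imageHom_map_iff e.injective)).wordProblemDecidable

theorem mainTheorem3 :
    (∃ (n : ℕ) (R : Set (FreeMonoid (Fin n) × FreeMonoid (Fin n))),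
      R.Finite ∧ IsHomogeneous R ∧ ¬ OConjDecidable R ∧
      (encodeRel R).Finite ∧ IsMultihomogeneous (encodeRel R) ∧
      ¬ OConjDecidable (encodeRel R)) ∧
    (∀ (n : ℕ) (R : Set (FreeMonoid (Fin n) × FreeMonoid (Fin n))), IsHomogeneous R →
      IsMultihomogeneous (encodeRel R) ∧
      ∃ f : PresMonoid R →* PresMonoid (encodeRel R),
        (∀ u : FreeMonoid (Fin n),
          f (PresMonoid.word R u) = PresMonoid.word (encodeRel R) (encode n u)) ∧
        Function.Injective f ∧
        ∀ p q : PresMonoid R, OConj (f p) (f q) ↔ OConj p q) := by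
  have hconj {n : ℕ} {R : Set (FreeMonoid (Fin n) × FreeMonoid (Fin n))} (hR : IsHomogeneous R) :=
    (isSolidCode_encode n).oConj_imageHom_iff (isMultihomogeneous_encodeRel hR).isHomogeneous
  obtain ⟨n, R, hfin, hR, hdec⟩ := exists_homogeneous_not_oConjDecidable
  refine ⟨⟨n, R, hfin, hR, hdec, hfin.image _, isMultihomogeneous_encodeRel hR,
    fun h => hdec (OConjDecidable.of_imageRel h (hconj hR))⟩, fun n R hR => ?_⟩
  exact ⟨isMultihomogeneous_encodeRel hR, PresMonoid.imageHom (encode n) R,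
    PresMonoid.imageHom_word (encode n),
    (isSolidCode_encode n).imageHom_injective (isMultihomogeneous_encodeRel hR).isHomogeneous,
    hconj hR⟩
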